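/- **Conventions.** A semiring $S=(S,+,\cdot,0,1)$ has an identity $1$ and an absorbing zero $0$, and need not be commutative; left $S$-semimodules are commutative monoids $(M,+,0)$ with a unital, biadditive and associative action of $S$ such that $0m=0$ and $s0=0$. A left $S$-semimodule is *finitely generated* (resp. *cyclic*) if it is a homomorphic image of a free left $S$-semimodule with a finite basis (resp. of ${}_SS$). The semiring $S$ is *simple* if its only semiring congruences are the equality relation and the universal relation $S^2$, and it has exactly two two-sided ideals, namely $0$ and $S$. A sequence $0\to A\xrightarrow{f}B\xrightarrow{g}C\to0$ of left $S$-semimodules is *short exact* if $f$ is a kernel of $g$ and $g$ is a cokernel of $f$ in the category of left $S$-semimodules; short exact sequences of commutative monoids are defined in the same way. A left $S$-semimodule $M$ is *e-injective* if for every short exact sequence $0\to A\to B\to C\to 0$ of left $S$-semimodules the induced sequence $0\to \mathrm{Hom}_S(C,M)\to \mathrm{Hom}_S(B,M)\to \mathrm{Hom}_S(A,M)\to 0$ of commutative monoids is short exact. For a finite distributive lattice $L$ with least element $0$, $\mathrm{End}(L)$ is the semiring of all endomorphisms of the commutative monoid $(L,\vee,0)$, with pointwise join as addition and composition as multiplication;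 $L$ is *nonzero* if it has more than one element. **Theorem 6.10.** The following conditions for a semiring $S$ are equivalent: 1. $S$ is simple and all finitely generated left $S$-semimodules are e-injective; 2. $S$ is simple and all cyclic left $S$-semimodules are e-injective; 3. $S$ is isomorphic, as a semiring, either to a matrix semiring $M_n(D)$ for some division ring $D$ and some $n\ge 1$, or to the endomorphism semiring $\mathrm{End}(L)$ of some nonzero finite distributive lattice $L$. -/

import Mathlib

universe u v

namespace Semimod

/-! Semirings have `0` and `1`, with `0` absorbing, and need not be commutative; a left semimodule
over `S` is a commutative monoid with a `Module S` structure. Monoids are identified with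
`ℕ`-semimodules, so monoid homomorphisms are `ℕ`-linear maps. -/

section Exactness

variable {R : Type v} [Semiring R]
variable {A B C : Type u} [AddCommMonoid A] [AddCommMonoid B] [AddCommMonoid C]
variable [Module R A] [Module R B] [Module R C]

/-- `k : A → B` is a kernel of `f : B → C` in the category of left `R`-semimodules. -/
def IsKernel (k : A →ₗ[R] B) (f : B →ₗ[R] C) : Prop :=
  f ∘ₗ k = 0 ∧
    ∀ (X : Type u) [AddCommMonoid X] [Module R X] (x : X →ₗ[R] B),
      f ∘ₗ x = 0 → ∃! i : X →ₗ[R] A, k ∘ₗ i = x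

/-- `c : B → C` is a cokernel of `f : A → B` in the category of left `R`-semimodules. -/
def IsCokernel (c : B →ₗ[R] C) (f : A →ₗ[R] B) : Prop :=
  c ∘ₗ f = 0 ∧
    ∀ (X : Type u) [AddCommMonoid X] [Module R X] (x : B →ₗ[R] X),
      x ∘ₗ f = 0 → ∃! i : C →ₗ[R] X, i ∘ₗ c = x

/-- `0 → A → B → C → 0` is a short exact sequence of left `R`-semimodules: the first map is a
kernel of the second one, and the second map is a cokernel of the first one. -/
def IsShortExact (f : A →ₗ[R] B) (g : B →ₗ[R] C) : Prop :=
  IsKernel f g ∧ IsCokernel g f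

end Exactness

/-- `M` is e-injective: the contravariant functor `Hom_S(-, M)` from left `S`-semimodules to
commutative monoids takes every short exact sequence `0 → A → B → C → 0` to a short exact sequence
`0 → Hom(C, M) → Hom(B, M) → Hom(A, M) → 0`. -/
def EInjective (S : Type u) [Semiring S] (M : Type u) [AddCommMonoid M] [Module S M] : Prop :=
  ∀ (A B C : Type u) [AddCommMonoid A] [AddCommMonoid B] [AddCommMonoid C]
    [Module S A] [Module S B] [Module S C] (f : A →ₗ[S] B) (g : B →ₗ[S] C),
    IsShortExact f g → IsShortExact (LinearMap.lcomp ℕ M g) (LinearMap.lcomp ℕ M f)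

/-- `M` is cyclic: a homomorphic image of the left semimodule `S`. -/
def IsCyclic (S : Type u) [Semiring S] (M : Type u) [AddCommMonoid M] [Module S M] : Prop :=
  ∃ p : S →ₗ[S] M, Function.Surjective p

/-- The only congruences on the semiring `S` are the equality and the universal relation. -/
def CongruenceSimple (S : Type u) [Semiring S] : Prop :=
  ∀ c : RingCon S, c = ⊥ ∨ c = ⊤

/-- `S` has exactly two (two-sided) ideals, namely `0` and `S`. -/
def IdealSimple (S : Type u) [Semiring S] : Prop :=
  (⊥ : Ideal S) ≠ ⊤ ∧ ∀ I : Ideal S, I.IsTwoSided → I = ⊥ ∨ I = ⊤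

/-- Simple semirings: congruence-simple and ideal-simple. -/
def SimpleSemiring (S : Type u) [Semiring S] : Prop :=
  CongruenceSimple S ∧ IdealSimple S

/-- The underlying set of the join-semilattice `L`, regarded as the commutative monoid
`(L, ⊔, ⊥)`. -/
def JoinMonoid (L : Type u) : Type u := L

instance JoinMonoid.instAdd (L : Type u) [SemilatticeSup L] : Add (JoinMonoid L) :=
  ⟨fun a b => @max L _ a b⟩

instance JoinMonoid.instZero (L : Type u) [SemilatticeSup L] [OrderBot L] : Zero (JoinMonoid L) :=
  ⟨(⊥ : L)⟩

instance JoinMonoid.instAddCommMonoid (L : Type u) [SemilatticeSup L] [OrderBot L] :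
    AddCommMonoid (JoinMonoid L) where
  add_assoc a b c := sup_assoc (α := L) a b c
  zero_add a := bot_sup_eq (α := L) a
  add_zero a := sup_bot_eq (α := L) a
  add_comm a b := sup_comm (α := L) a b
  nsmul := nsmulRec

/-- The endomorphism semiring `End(L)` of `(L, ⊔, ⊥)`: all maps `L → L` preserving finite joins
(including the empty one), with pointwise join as addition and composition as multiplication. -/
abbrev EndSemiring (L : Type u) [SemilatticeSup L] [OrderBot L] : Type u :=
  AddMonoid.End (JoinMonoid L)

end Semimod

/-! Testing e-injectivity amounts to testing restriction along inclusions of subtractive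
subsemimodules. A simple semiring `S` is either a ring or additively idempotent, and the two cases
give the two families.

Over a ring, subtractive subsemimodules are submodules and e-injectivity is ordinary injectivity.
Osofsky's theorem makes a ring with injective cyclic modules semisimple, and Wedderburn–Artin
finishes. Conversely, all modules over a semisimple ring are injective.

If `S` is idempotent, e-injectivity of `S` produces a greatest element `u`. Simplicity forces `u * s
* u = u` for every `s ≠ 0`, and `S u S = S` writes `1` as a finite sum of terms `x i * u * y i`.
Thus `S` is Morita equivalent to the Boolean semiring, which is the content of `BooleanCorner`; the
left ideal `S u` is a finite distributive lattice, and `S` acts on it as its full endomorphism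
semiring.

Conversely, `End(L)` has such a corner, generated by the map sending every nonzero element to the
top. With a corner, linear maps are recovered from additive maps, and a map on a subtractive
subsemimodule extends by sending its complement to a greatest element of the target. Finitely
generated semimodules over the finite semiring `End(L)` are finite, so they have one. -/

namespace Semimod

/-! ### Kernels, cokernels and short exact sequences -/

section Exactness

variable {R : Type v} [Semiring R]
variable {A B C : Type u} [AddCommMonoid A] [AddCommMonoid B] [AddCommMonoid C]
variable [Module R A] [Module R B] [Module R C]

theorem isKernel_of_injective {k : A →ₗ[R] B} {f : B →ₗ[R] C} (hk : Function.Injective k)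
    (h : ∀ b, f b = 0 ↔ ∃ a, k a = b) : IsKernel k f := by
  refine ⟨LinearMap.ext fun a => (h _).2 ⟨a, rfl⟩, fun X _ _ x hx => ?_⟩
  have h' : ∀ t, ∃ a, k a = x t := fun t => (h _).1 (LinearMap.congr_fun hx t)
  choose i hi using h'
  refine ⟨{ toFun := i, map_add' := fun s t => hk ?_, map_smul' := fun r t => hk ?_ },
    LinearMap.ext hi, fun j hj => LinearMap.ext fun t => hk ?_⟩
  · simp [hi]
  · simp [hi]
  · exact (LinearMap.congr_fun hj t).trans (hi t).symm

theorem isCokernel_of_surjective {c : B →ₗ[R] C} {f : A →ₗ[R] B} (hc : Function.Surjective c)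
    (h0 : c ∘ₗ f = 0) (h : ∀ b b', c b = c b' → ∃ a a', b + f a = b' + f a') :
    IsCokernel c f := by
  refine ⟨h0, fun X _ _ x hx => ?_⟩
  have key : ∀ b b', c b = c b' → x b = x b' := fun b b' hb => by
    obtain ⟨a, a', e⟩ := h b b' hb
    have hx' : ∀ a, x (f a) = 0 := LinearMap.congr_fun hx
    simpa [hx'] using congrArg x e
  choose s hs using hc
  refine ⟨{ toFun := fun z => x (s z), map_add' := fun y z => ?_, map_smul' := fun r z => ?_ },
    LinearMap.ext fun b => key _ _ (hs _), fun j hj => LinearMap.ext fun z => ?_⟩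
  · rw [← map_add]
    exact key _ _ (by simp [hs])
  · rw [RingHom.id_apply, ← map_smul]
    exact key _ _ (by simp [hs])
  · have hj' : j ∘ₗ c = x := hj
    simpa [hs] using LinearMap.congr_fun hj' (s z)

theorem IsCokernel.surjective {c : B →ₗ[R] C} {f : A →ₗ[R] B} (h : IsCokernel c f) :
    Function.Surjective c := by
  obtain ⟨i, hi, -⟩ := h.2 (LinearMap.range c) c.rangeRestrict
    (LinearMap.ext fun a => Subtype.ext (LinearMap.congr_fun h.1 a))
  have hid : (LinearMap.range c).subtype ∘ₗ i = LinearMap.id :=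
    (h.2 C c h.1).unique (by rw [LinearMap.comp_assoc, hi]; rfl) (LinearMap.id_comp c)
  intro z
  obtain ⟨b, hb⟩ := (i z).2
  exact ⟨b, hb.trans (LinearMap.congr_fun hid z)⟩

/-- The quotient is by the congruence `b + f a = b' + f a'`; subtractivity says exactly that the
class of `0` is the image of `f`. -/
theorem exists_isShortExact {f : A →ₗ[R] B} (hf : Function.Injective f)
    (hs : ∀ b a a', b + f a = f a' → ∃ a'', f a'' = b) :
    ∃ (D : Type u) (_ : AddCommMonoid D) (_ : Module R D) (g : B →ₗ[R] D),
      IsShortExact f g := by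
  let c : ModuleCon R B :=
    { r := fun b b' => ∃ a a', b + f a = b' + f a'
      iseqv := ⟨fun b => ⟨0, 0, rfl⟩, fun ⟨a, a', h⟩ => ⟨a', a, h.symm⟩,
        fun {x y z} ⟨a, a', h⟩ ⟨b, b', h'⟩ => ⟨a + b, b' + a', by
          rw [map_add, map_add, ← add_assoc, h, add_right_comm, h', add_assoc]⟩⟩
      add' := fun {w x y z} ⟨a, a', h⟩ ⟨b, b', h'⟩ => ⟨a + b, a' + b', by
        rw [map_add, map_add, add_add_add_comm, h, h', add_add_add_comm]⟩
      smul := fun s {x y} ⟨a, a', h⟩ => ⟨s • a, s • a', by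
        rw [map_smul, map_smul, ← smul_add, h, smul_add]⟩ }
  let g : B →ₗ[R] c.Quotient :=
    { toFun := fun b => Quotient.mk c.toSetoid b
      map_add' := fun _ _ => rfl
      map_smul' := fun _ _ => rfl }
  have hg : ∀ b b', g b = g b' ↔ ∃ a a', b + f a = b' + f a' := fun b b' => Quotient.eq
  refine ⟨c.Quotient, inferInstance, inferInstance, g, isKernel_of_injective hf fun b => ?_,
    isCokernel_of_surjective Quotient.mk_surjective ?_ fun b b' => (hg b b').1⟩
  · rw [← map_zero g, hg]
    constructor
    · rintro ⟨a, a', h⟩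
      exact hs b a a' (by rwa [zero_add] at h)
    · rintro ⟨a, rfl⟩
      exact ⟨0, a, by simp⟩
  · ext a
    change g (f a) = 0
    rw [← map_zero g, hg]
    exact ⟨0, a, by simp⟩

end Exactness

/-! ### e-injectivity and subtractive subsemimodules -/

section EInjective

variable {S : Type u} [Semiring S] {M : Type u} [AddCommMonoid M] [Module S M]
variable {A B C : Type u} [AddCommMonoid A] [AddCommMonoid B] [AddCommMonoid C]
variable [Module S A] [Module S B] [Module S C]

theorem IsKernel.injective {k : A →ₗ[S] B} {f : B →ₗ[S] C} (h : IsKernel k f) :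
    Function.Injective k := by
  intro a a' e
  have hx : f ∘ₗ LinearMap.toSpanSingleton S B (k a) = 0 := by
    ext
    simpa using LinearMap.congr_fun h.1 a
  have := (h.2 S _ hx).unique (y₁ := LinearMap.toSpanSingleton S A a)
    (y₂ := LinearMap.toSpanSingleton S A a') (by ext; simp) (by ext; simp [e])
  simpa using LinearMap.congr_fun this 1

theorem IsKernel.exists_eq {k : A →ₗ[S] B} {f : B →ₗ[S] C} (h : IsKernel k f) {b : B}
    (hb : f b = 0) : ∃ a, k a = b := by
  obtain ⟨i, hi, -⟩ := h.2 S (LinearMap.toSpanSingleton S B b) (by ext; simpa using hb)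
  exact ⟨i 1, by simpa using LinearMap.congr_fun hi 1⟩

/-- Homomorphisms from a subtractive subsemimodule into an e-injective semimodule extend. -/
theorem EInjective.exists_extension (hM : EInjective S M) {f : A →ₗ[S] B}
    (hf : Function.Injective f) (hs : ∀ b a a', b + f a = f a' → ∃ a'', f a'' = b)
    (φ : A →ₗ[S] M) : ∃ ψ : B →ₗ[S] M, ∀ a, ψ (f a) = φ a := by
  obtain ⟨D, _, _, g, hg⟩ := exists_isShortExact hf hs
  obtain ⟨ψ, hψ⟩ := (hM A B D f g hg).2.surjective φ
  exact ⟨ψ, LinearMap.congr_fun hψ⟩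

/-- Left exactness of `Hom(-, M)` is automatic from the cokernel property. What remains is that
restriction to `A` is a cokernel: it must be onto, and maps with equal restriction must agree after
adding maps that vanish on `A`. -/
theorem eInjective_of_extension
    (h : ∀ (A B : Type u) [AddCommMonoid A] [AddCommMonoid B] [Module S A] [Module S B]
      (f : A →ₗ[S] B), Function.Injective f → (∀ b a a', b + f a = f a' → ∃ a'', f a'' = b) →
      (∀ φ : A →ₗ[S] M, ∃ ψ : B →ₗ[S] M, ψ ∘ₗ f = φ) ∧
      ∀ φ ψ : B →ₗ[S] M, φ ∘ₗ f = ψ ∘ₗ f →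
        ∃ α β : B →ₗ[S] M, α ∘ₗ f = 0 ∧ β ∘ₗ f = 0 ∧ φ + α = ψ + β) :
    EInjective S M := by
  intro A B C _ _ _ _ _ _ f g hfg
  obtain ⟨ext, diff⟩ := h A B f hfg.1.injective fun b a a' e => by
    refine hfg.1.exists_eq ?_
    have h0 : ∀ a, g (f a) = 0 := LinearMap.congr_fun hfg.1.1
    simpa [h0] using congrArg g e
  refine ⟨isKernel_of_injective ?_ fun φ => ?_, isCokernel_of_surjective ext ?_ fun φ ψ e => ?_⟩
  · intro α β e
    have e' : α ∘ₗ g = β ∘ₗ g := e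
    exact (hfg.2.2 M (β ∘ₗ g) (by rw [LinearMap.comp_assoc, hfg.2.1, LinearMap.comp_zero])).unique
      e' rfl
  · constructor
    · intro e
      exact (hfg.2.2 M φ e).exists
    · rintro ⟨α, rfl⟩
      change (α ∘ₗ g) ∘ₗ f = 0
      rw [LinearMap.comp_assoc, hfg.2.1, LinearMap.comp_zero]
  · ext α : 1
    change (α ∘ₗ g) ∘ₗ f = 0
    rw [LinearMap.comp_assoc, hfg.2.1, LinearMap.comp_zero]
  · obtain ⟨α, β, hα, hβ, e'⟩ := diff φ ψ e
    obtain ⟨α', rfl, -⟩ := hfg.2.2 M α hα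
    obtain ⟨β', rfl, -⟩ := hfg.2.2 M β hβ
    exact ⟨α', β', e'⟩

end EInjective

/-- An idempotent `e` of an additively idempotent semiring `S` with `S e S = S` and
`e S e = {0, e}`: the data making `S` Morita equivalent to the Boolean semiring. -/
structure BooleanCorner (S : Type u) [Semiring S] where
  one_add_one : (1 : S) + 1 = 1
  e : S
  e_ne_zero : e ≠ 0
  e_mul_e : e * e = e
  corner : ∀ s, e * s * e = 0 ∨ e * s * e = e
  ι : Type u
  fintype : Fintype ι
  x : ι → S
  y : ι → S
  sum_eq_one : ∑ i, x i * e * y i = 1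

/-! ### Boolean corners: simplicity and extension of maps -/

namespace BooleanCorner

attribute [instance] BooleanCorner.fintype

section

variable {S : Type u} [Semiring S] (K : BooleanCorner S)

/-- Transport of a Boolean corner along a semiring isomorphism. -/
def map {T : Type u} [Semiring T] (f : S ≃+* T) : BooleanCorner T where
  one_add_one := by rw [← map_one f, ← map_add, K.one_add_one]
  e := f K.e
  e_ne_zero := by simpa using K.e_ne_zero
  e_mul_e := by rw [← map_mul, K.e_mul_e]
  corner t := by
    obtain ⟨s, rfl⟩ := f.surjective t
    simp only [← map_mul]
    exact (K.corner s).imp (fun h => by rw [h, map_zero]) fun h => by rw [h]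
  ι := K.ι
  fintype := K.fintype
  x i := f (K.x i)
  y i := f (K.y i)
  sum_eq_one := by simp only [← map_mul, ← map_sum, K.sum_eq_one, map_one]

include K in
theorem add_self {M : Type*} [AddCommMonoid M] [Module S M] (m : M) : m + m = m := by
  have := congrArg (· • m) K.one_add_one
  simpa [add_smul] using this

theorem sum_smul_eq {M : Type*} [AddCommMonoid M] [Module S M] (m : M) :
    ∑ i, K.x i • K.e • K.e • K.y i • m = m := by
  have := congrArg (· • m) K.sum_eq_one
  simp only [Finset.sum_smul, mul_smul, one_smul] at this
  simpa only [← mul_smul K.e K.e, K.e_mul_e] using this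

/-- As with matrix units, `s` is recovered from its entries in the corner `{0, e}`. -/
theorem sum_mul_eq (s : S) :
    s = ∑ i, ∑ j, K.x i * (K.e * (K.y i * s * K.x j) * K.e) * K.y j := by
  calc s = (∑ i, K.x i * K.e * K.y i) * s * ∑ j, K.x j * K.e * K.y j := by
        rw [K.sum_eq_one, one_mul, mul_one]
    _ = _ := by
        rw [Finset.sum_comm]
        simp only [Finset.sum_mul, Finset.mul_sum, mul_assoc]

theorem one_mem_of_e_mem (I : Ideal S) (hI : I.IsTwoSided) (he : K.e ∈ I) : I = ⊤ := by
  rw [Ideal.eq_top_iff_one, ← K.sum_eq_one]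
  exact I.sum_mem fun i _ => hI.mul_mem_of_left _ (I.mul_mem_left _ he)

include K in
theorem simpleSemiring : SimpleSemiring S := by
  refine ⟨fun c => ?_, fun h => ?_, fun I hI => ?_⟩
  · by_contra! hc
    obtain ⟨s, t, hst, hne⟩ : ∃ s t, c s t ∧ s ≠ t := by
      by_contra! h
      exact hc.1 (RingCon.ext fun s t => ⟨fun hst => h s t hst, fun hst => by
        rw [show s = t from hst]; exact c.refl t⟩)
    obtain ⟨i, j, hij⟩ : ∃ i j, K.e * (K.y i * s * K.x j) * K.e ≠
        K.e * (K.y i * t * K.x j) * K.e := by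
      by_contra! h
      apply hne
      rw [K.sum_mul_eq s, K.sum_mul_eq t]
      simp only [h]
    have hcij : c (K.e * (K.y i * s * K.x j) * K.e) (K.e * (K.y i * t * K.x j) * K.e) :=
      c.mul (c.mul (c.refl _) (c.mul (c.mul (c.refl _) hst) (c.refl _))) (c.refl _)
    -- Two distinct entries in `{0, e}` are `0` and `e`, so the congruence identifies them.
    have he : c K.e 0 := by
      rcases K.corner (K.y i * s * K.x j) with h | h <;>
        rcases K.corner (K.y i * t * K.x j) with h' | h' <;> rw [h, h'] at hij hcij
      · exact absurd rfl hij
      · exact c.symm hcij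
      · exact hcij
      · exact absurd rfl hij
    have h1 : c 1 0 := by
      have : c (∑ i, K.x i * K.e * K.y i) (∑ i, K.x i * 0 * K.y i) :=
        c.finsetSum _ fun i _ => c.mul (c.mul (c.refl _) he) (c.refl _)
      simpa [K.sum_eq_one] using this
    apply hc.2
    refine RingCon.ext fun s t => ⟨fun _ => trivial, fun _ => ?_⟩
    have hs : ∀ s, c s 0 := fun s => by simpa using c.mul (c.refl s) h1
    exact c.trans (hs s) (c.symm (hs t))
  · have : K.e ∈ (⊥ : Ideal S) := h ▸ Submodule.mem_top
    exact K.e_ne_zero (by simpa using this)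
  · rw [or_iff_not_imp_left]
    intro hne
    obtain ⟨s, hs, hs0⟩ := Submodule.exists_mem_ne_zero_of_ne_bot hne
    obtain ⟨i, j, hij⟩ : ∃ i j, K.e * (K.y i * s * K.x j) * K.e ≠ 0 := by
      by_contra! h
      apply hs0
      rw [K.sum_mul_eq s]
      simp only [h, mul_zero, zero_mul, Finset.sum_const_zero]
    refine K.one_mem_of_e_mem I hI ?_
    rw [← (K.corner (K.y i * s * K.x j)).resolve_left hij]
    exact hI.mul_mem_of_left _ (I.mul_mem_left _
      (hI.mul_mem_of_left _ (I.mul_mem_left _ hs)))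

end

section EInjective

variable {S : Type u} [Semiring S] (K : BooleanCorner S)
variable {M : Type u} [AddCommMonoid M] [Module S M]
variable {A B : Type u} [AddCommMonoid A] [AddCommMonoid B] [Module S A] [Module S B]

/-- The `S`-linear map determined by an additive map between the corners `e M`. -/
def lift (h : B →+ M) : B →ₗ[S] M where
  toFun b := ∑ i, K.x i • K.e • h (K.e • K.y i • b)
  map_add' b b' := by simp [Finset.sum_add_distrib]
  map_smul' s b := by
    -- The corner acts only through `0` and `e`, so an additive `h` commutes with it once cut down
    -- by `e`.
    have key : ∀ i, K.e • h (K.e • K.y i • s • b) =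
        ∑ j, (K.e * (K.y i * s * K.x j) * K.e) • h (K.e • K.y j • b) := by
      intro i
      conv_lhs => rw [← K.sum_smul_eq b]
      simp only [Finset.smul_sum, map_sum]
      refine Finset.sum_congr rfl fun j _ => ?_
      rw [← mul_smul (K.x j) K.e, ← mul_smul s, ← mul_smul (K.y i), ← mul_smul K.e,
        show K.e * (K.y i * (s * (K.x j * K.e))) = K.e * (K.y i * s * K.x j) * K.e by
          simp only [mul_assoc]]
      rcases K.corner (K.y i * s * K.x j) with h' | h'
      · rw [h', zero_smul, zero_smul, map_zero, smul_zero]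
      · rw [h', ← mul_smul K.e K.e (K.y j • b), K.e_mul_e]
    simp only [key, RingHom.id_apply]
    calc ∑ i, K.x i • ∑ j, (K.e * (K.y i * s * K.x j) * K.e) • h (K.e • K.y j • b)
        = ∑ j, (∑ i, K.x i * K.e * K.y i) • s • K.x j • K.e • h (K.e • K.y j • b) := by
          simp only [Finset.smul_sum, Finset.sum_smul]
          rw [Finset.sum_comm]
          simp only [← mul_smul, mul_assoc]
      _ = _ := by simp only [K.sum_eq_one, one_smul, Finset.smul_sum]

theorem lift_apply (h : B →+ M) (b : B) :
    K.lift h b = ∑ i, K.x i • K.e • h (K.e • K.y i • b) := rfl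

theorem lift_coe (φ : B →ₗ[S] M) : K.lift φ.toAddMonoidHom = φ := by
  ext b
  conv_rhs => rw [← K.sum_smul_eq b]
  simp [lift_apply]

open Classical in
/-- The extension of an additive map from a subtractive `A ⊆ B` which is constantly `t`
outside `A`. -/
noncomputable def extendByTop {f : A →ₗ[S] B} (hf : Function.Injective f)
    (hs : ∀ b a a', b + f a = f a' → ∃ a'', f a'' = b) {t : M} (ht : ∀ m, m + t = t)
    (hB : ∀ b : B, b + b = b) (φ : A →ₗ[S] M) : B →+ M where
  toFun b := if h : ∃ a, f a = b then φ h.choose else t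
  map_zero' := by
    have h : ∃ a, f a = 0 := ⟨0, map_zero f⟩
    rw [dif_pos h, show h.choose = 0 from hf (by rw [h.choose_spec, map_zero]), map_zero]
  map_add' b b' := by
    -- By idempotence `b + (b + b') = b + b'`, so the subtractive image is closed downwards and its
    -- complement absorbs sums.
    have left : ∀ b b', (∃ a, f a = b + b') → ∃ a, f a = b := fun b b' ⟨a, ha⟩ =>
      hs b a a (by rw [ha, ← add_assoc, hB])
    by_cases h : ∃ a, f a = b
    · by_cases h' : ∃ a, f a = b'
      · have h'' : ∃ a, f a = b + b' :=
          ⟨h.choose + h'.choose, by rw [map_add, h.choose_spec, h'.choose_spec]⟩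
        rw [dif_pos h, dif_pos h', dif_pos h'', ← map_add]
        congr 1
        exact hf (by rw [map_add, h.choose_spec, h'.choose_spec, h''.choose_spec])
      · rw [dif_neg h', ht, dif_neg]
        exact fun h'' => h' (left b' b (by rwa [add_comm]))
    · rw [dif_neg h, add_comm t, ht, dif_neg]
      exact fun h'' => h (left b b' h'')

section extendByTop

variable {f : A →ₗ[S] B} (hf : Function.Injective f)
    (hs : ∀ b a a', b + f a = f a' → ∃ a'', f a'' = b) {t : M} (ht : ∀ m, m + t = t)
    (hB : ∀ b : B, b + b = b) (φ : A →ₗ[S] M)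

theorem extendByTop_apply (a : A) : extendByTop hf hs ht hB φ (f a) = φ a := by
  have h : ∃ a', f a' = f a := ⟨a, rfl⟩
  exact (dif_pos h).trans (congrArg φ (hf h.choose_spec))

theorem extendByTop_of_notMem {b : B} (hb : ¬ ∃ a, f a = b) :
    extendByTop hf hs ht hB φ b = t :=
  dif_neg hb

theorem lift_extendByTop_comp : K.lift (extendByTop hf hs ht hB φ) ∘ₗ f = φ := by
  ext a
  conv_rhs => rw [← K.lift_coe φ]
  simp only [LinearMap.comp_apply, lift_apply]
  refine Finset.sum_congr rfl fun i _ => ?_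
  rw [← map_smul f, ← map_smul f, extendByTop_apply]
  rfl

end extendByTop

include K in
theorem eInjective_of_exists_top (h : ∃ t : M, ∀ m, m + t = t) : EInjective S M := by
  obtain ⟨t, ht⟩ := h
  refine eInjective_of_extension fun A B _ _ _ _ f hf hs => ?_
  refine ⟨fun φ => ⟨_, K.lift_extendByTop_comp hf hs ht K.add_self φ⟩, fun φ ψ e => ?_⟩
  -- Both correction maps lift the map that is `0` on the image of `A` and `t` elsewhere: it hides
  -- any difference off `A`.
  refine ⟨_, _, K.lift_extendByTop_comp hf hs ht K.add_self 0,
    K.lift_extendByTop_comp hf hs ht K.add_self 0, ?_⟩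
  ext b
  rw [← K.lift_coe φ, ← K.lift_coe ψ]
  simp only [LinearMap.add_apply, lift_apply, ← Finset.sum_add_distrib, ← smul_add]
  refine Finset.sum_congr rfl fun i _ => ?_
  congr 2
  by_cases hb : ∃ a, f a = K.e • K.y i • b
  · obtain ⟨a, ha⟩ := hb
    rw [← ha]
    congr 1
    exact LinearMap.congr_fun e a
  · rw [extendByTop_of_notMem _ _ _ _ _ hb, ht, ht]

include K in
theorem eInjective_of_finite [Finite M] : EInjective S M := by
  have := Fintype.ofFinite M
  refine K.eInjective_of_exists_top ⟨∑ m : M, m, fun m => ?_⟩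
  classical
  rw [← Finset.add_sum_erase _ _ (Finset.mem_univ m), ← add_assoc, K.add_self]

end EInjective
end BooleanCorner

/-! ### The Boolean corner of `End(L)` -/

section EndSemiring

variable {L : Type u}

section

variable [SemilatticeSup L] [OrderBot L]

theorem EndSemiring.sum_apply {α : Type*} (s : Finset α) (f : α → EndSemiring L)
    (x : JoinMonoid L) : (∑ i ∈ s, f i) x = ∑ i ∈ s, f i x :=
  AddMonoidHom.finsetSum_apply f s x

instance [Finite L] : Finite (EndSemiring L) :=
  Finite.of_injective (β := L → L) (fun f => f) fun _ _ h => AddMonoidHom.ext (congrFun h)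

open Classical in
theorem ite_sup_le (a b x y : L) : (if x ⊔ y ≤ a then ⊥ else b) =
    (if x ≤ a then ⊥ else b) ⊔ (if y ≤ a then ⊥ else b) := by
  by_cases hx : x ≤ a <;> by_cases hy : y ≤ a <;> simp [hx, hy]

open Classical in
/-- The endomorphism of `(L, ⊔, ⊥)` sending everything below `a` to `⊥` and the rest to `b`. -/
noncomputable def rankOne (a b : L) : EndSemiring L where
  toFun x := if @LE.le L _ x a then (⊥ : L) else b
  map_zero' := if_pos (bot_le (α := L))
  map_add' x y := ite_sup_le a b x y

theorem rankOne_of_le {a : L} (b : L) {x : L} (h : x ≤ a) :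
    rankOne a b (show JoinMonoid L from x) = (⊥ : L) := if_pos h

theorem rankOne_of_not_le {a : L} (b : L) {x : L} (h : ¬ x ≤ a) :
    rankOne a b (show JoinMonoid L from x) = b := if_neg h

theorem map_bot (f : EndSemiring L) : f (⊥ : L) = (⊥ : L) := map_zero f

end

variable [DistribLattice L] [OrderBot L] [Finite L]

/-- In a distributive lattice `j` is join-prime, so the join of all elements not above `j` is still
not above `j`. -/
theorem exists_separating {j : L} (hj : SupIrred j) : ∃ a : L, ∀ x, x ≤ a ↔ ¬ j ≤ x := by
  classical
  have := Fintype.ofFinite L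
  have hj' : SupPrime j := hj.supPrime
  refine ⟨(Finset.univ.filter fun x => ¬ j ≤ x).sup id, fun x => ⟨fun h h' => ?_, fun h => ?_⟩⟩
  · obtain ⟨y, hy, hjy⟩ := hj'.le_finset_sup.1 (h'.trans h)
    exact (Finset.mem_filter.1 hy).2 hjy
  · exact Finset.le_sup (f := id) (Finset.mem_filter.2 ⟨Finset.mem_univ x, h⟩)

variable (L) in
theorem nonempty_booleanCorner_endSemiring [Nontrivial L] :
    Nonempty (BooleanCorner (EndSemiring L)) := by
  classical
  have := Fintype.ofFinite L
  obtain ⟨t, ht⟩ : ∃ t : L, ∀ x, x ≤ t :=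
    ⟨Finset.univ.sup id, fun x => Finset.le_sup (f := id) (Finset.mem_univ x)⟩
  have htb : ¬ t ≤ ⊥ := fun h => by
    obtain ⟨a, b, hab⟩ := exists_pair_ne L
    exact hab (((ht a).trans h).antisymm bot_le |>.trans (((ht b).trans h).antisymm bot_le).symm)
  have hcomp : ∀ f : EndSemiring L,
      rankOne ⊥ t * f * rankOne ⊥ t = if f t = (⊥ : L) then 0 else rankOne ⊥ t := by
    intro f
    refine AddMonoidHom.ext fun x => ?_
    change rankOne ⊥ t (f (rankOne ⊥ t x)) = _
    by_cases hx : @LE.le L _ x ⊥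
    · rw [rankOne_of_le _ hx, map_bot, map_bot]
      split_ifs
      · rfl
      · exact (rankOne_of_le _ hx).symm
    · rw [rankOne_of_not_le _ hx]
      split_ifs with h
      · rw [h, map_bot]; rfl
      · exact (rankOne_of_not_le t fun h' => h (le_antisymm (α := L) h' bot_le)).trans
          (rankOne_of_not_le t hx).symm
  refine ⟨{
    one_add_one := AddMonoidHom.ext fun x => sup_idem (α := L) x
    e := rankOne ⊥ t
    e_ne_zero := fun h => htb ?_
    e_mul_e := ?_
    corner := fun s => ?_
    -- These are the pairs whose `rankOne` map lies below the identity; pairs from join-irreducibles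
    -- already make the sum reach it.
    ι := {p : L × L // ∀ x, x ≤ p.1 ∨ p.2 ≤ x}
    fintype := inferInstance
    x := fun p => rankOne ⊥ p.1.2
    y := fun p => rankOne p.1.1 t
    sum_eq_one := ?_ }⟩
  · have := DFunLike.congr_fun h (show JoinMonoid L from t)
    rw [rankOne_of_not_le t htb] at this
    exact le_of_eq this
  · have := hcomp 1
    rw [mul_one, if_neg] at this
    · exact this
    · exact fun h => htb (le_of_eq h)
  · rw [hcomp]
    split_ifs
    exacts [.inl rfl, .inr rfl]
  · refine AddMonoidHom.ext fun x => ?_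
    have term : ∀ p : {p : L × L // ∀ x, x ≤ p.1 ∨ p.2 ≤ x},
        (rankOne ⊥ p.1.2 * rankOne ⊥ t * rankOne p.1.1 t : EndSemiring L) = rankOne p.1.1 p.1.2 := by
      intro p
      refine AddMonoidHom.ext fun x => ?_
      change rankOne ⊥ p.1.2 (rankOne ⊥ t (rankOne p.1.1 t x)) = _
      by_cases hx : @LE.le L _ x p.1.1
      · rw [rankOne_of_le _ hx, map_bot, map_bot]
        exact (rankOne_of_le _ hx).symm
      · rw [rankOne_of_not_le _ hx, rankOne_of_not_le _ htb, rankOne_of_not_le _ htb]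
        exact (rankOne_of_not_le _ hx).symm
    simp only [term]
    refine (EndSemiring.sum_apply _ _ x).trans ?_
    change _ = x
    refine le_antisymm (α := L) ?_ ?_
    · refine Finset.sum_induction _ (fun z : JoinMonoid L => @LE.le L _ z x)
        (fun _ _ => sup_le (α := L)) (bot_le (α := L)) fun p _ => ?_
      by_cases hx : @LE.le L _ x p.1.1
      · rw [rankOne_of_le _ hx]
        exact bot_le
      · rw [rankOne_of_not_le _ hx]
        exact (p.2 x).resolve_left hx
    · obtain ⟨s, hs, hirr⟩ := exists_supIrred_decomposition (α := L) x
      conv_lhs => rw [← hs]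
      refine Finset.sup_le fun j hj => ?_
      have hjx : @LE.le L _ j x := hs ▸ Finset.le_sup (f := id) hj
      obtain ⟨a, ha⟩ := exists_separating (hirr hj)
      let p : {p : L × L // ∀ x, x ≤ p.1 ∨ p.2 ≤ x} :=
        ⟨(a, j), fun x => by rw [ha]; exact (em (j ≤ x)).symm⟩
      rw [← Finset.add_sum_erase _ _ (Finset.mem_univ p)]
      refine le_trans (α := L) ?_ (le_sup_left (α := L))
      refine le_of_eq (α := L) (rankOne_of_not_le j ?_).symm
      exact fun h => (ha x).1 h hjx

end EndSemiring

/-! ### The lattice `S e` and the isomorphism with its endomorphism semiring -/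

namespace BooleanCorner

variable {S : Type u} [Semiring S] (K : BooleanCorner S)

/-- The left ideal `S e`, which is a finite distributive lattice. -/
def CornerLattice : Type u := {s : S // s * K.e = s}

namespace CornerLattice

variable {K}

@[ext] theorem ext {a b : K.CornerLattice} (h : a.1 = b.1) : a = b := Subtype.ext h

variable (K) in
/-- The generators of the left ideal `S e`. -/
def gen (i : K.ι) : K.CornerLattice := ⟨K.x i * K.e, by rw [mul_assoc, K.e_mul_e]⟩

instance : Max K.CornerLattice := ⟨fun a b => ⟨a.1 + b.1, by rw [add_mul, a.2, b.2]⟩⟩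

instance : PartialOrder K.CornerLattice where
  le a b := a.1 + b.1 = b.1
  le_refl a := K.add_self a.1
  le_trans a b c h h' := by rw [← h', ← add_assoc, h]
  le_antisymm a b h h' := ext (by rw [← h', add_comm, h])

theorem le_def {a b : K.CornerLattice} : a ≤ b ↔ a.1 + b.1 = b.1 := Iff.rfl

instance : SemilatticeSup K.CornerLattice where
  sup := max
  le_sup_left a b := by
    change a.1 + (a.1 + b.1) = a.1 + b.1
    rw [← add_assoc, K.add_self]
  le_sup_right a b := by
    change b.1 + (a.1 + b.1) = a.1 + b.1
    rw [add_left_comm, K.add_self]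
  sup_le a b c h h' := by
    change a.1 + b.1 + c.1 = c.1
    rw [add_assoc, h', h]

instance : OrderBot K.CornerLattice where
  bot := ⟨0, zero_mul _⟩
  bot_le a := zero_add a.1

theorem sup_val (a b : K.CornerLattice) : (a ⊔ b).1 = a.1 + b.1 := rfl

theorem sup_finset_val {α : Type*} (s : Finset α) (g : α → K.CornerLattice) :
    (s.sup g).1 = ∑ i ∈ s, (g i).1 := by
  classical
  induction s using Finset.induction_on with
  | empty => rfl
  | insert a s ha ih => rw [Finset.sup_insert, sup_val, ih, Finset.sum_insert ha]

open Classical in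
/-- The generators detected by `a`. -/
noncomputable def supp (a : K.CornerLattice) : Finset K.ι :=
  Finset.univ.filter fun i => K.e * K.y i * a.1 ≠ 0

theorem corner_mul (i : K.ι) (a : K.CornerLattice) :
    K.e * K.y i * a.1 = 0 ∨ K.e * K.y i * a.1 = K.e := by
  have := K.corner (K.y i * a.1)
  rwa [mul_assoc K.e, mul_assoc, a.2, ← mul_assoc] at this

theorem mem_supp {a : K.CornerLattice} {i : K.ι} : i ∈ supp a ↔ K.e * K.y i * a.1 ≠ 0 := by
  simp [supp]

theorem sup_supp (a : K.CornerLattice) : (supp a).sup (gen K) = a := by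
  classical
  refine ext ?_
  rw [sup_finset_val]
  conv_rhs => rw [← one_mul a.1, ← K.sum_eq_one, Finset.sum_mul]
  rw [supp, Finset.sum_filter]
  refine Finset.sum_congr rfl fun i _ => ?_
  rw [mul_assoc (K.x i), mul_assoc (K.x i)]
  rcases corner_mul i a with h | h <;> rw [h]
  · simp
  · rw [if_pos K.e_ne_zero]
    rfl

instance : Finite K.CornerLattice :=
  Finite.of_injective supp fun a b h => by rw [← sup_supp a, h, sup_supp]

theorem supp_sup (a b : K.CornerLattice) : ∀ i ∈ supp (a ⊔ b), i ∈ supp a ∨ i ∈ supp b := by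
  intro i
  simp only [mem_supp]
  contrapose!
  rintro ⟨h, h'⟩
  rw [sup_val, mul_add, h, h', add_zero]

theorem gen_le {a : K.CornerLattice} {i : K.ι} (h : i ∈ supp a) : gen K i ≤ a := by
  conv_rhs => rw [← sup_supp a]
  exact Finset.le_sup h

open Classical in
noncomputable instance : Lattice K.CornerLattice where
  __ := (inferInstance : SemilatticeSup K.CornerLattice)
  inf a b := (Finset.univ.filter fun i => gen K i ≤ a ∧ gen K i ≤ b).sup (gen K)
  inf_le_left a b := Finset.sup_le fun i hi => (Finset.mem_filter.1 hi).2.1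
  inf_le_right a b := Finset.sup_le fun i hi => (Finset.mem_filter.1 hi).2.2
  le_inf a b c h h' := by
    conv_lhs => rw [← sup_supp a]
    refine Finset.sup_le fun i hi => Finset.le_sup (f := gen K) (Finset.mem_filter.2
      ⟨Finset.mem_univ i, (gen_le hi).trans h, (gen_le hi).trans h'⟩)

/-- Left multiplication by `e * y i` is additive with values in `{0, e}`, so a generator detected by
`b ⊔ c` is detected by `b` or by `c`. -/
noncomputable instance : DistribLattice K.CornerLattice :=
  DistribLattice.ofInfSupLe fun a b c => by
    conv_lhs => rw [← sup_supp (a ⊓ (b ⊔ c))]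
    refine Finset.sup_le fun i hi => ?_
    have hia : gen K i ≤ a := (gen_le hi).trans inf_le_left
    have hi' : i ∈ supp (b ⊔ c) := by
      rw [mem_supp] at hi ⊢
      intro h
      apply hi
      have hle : a ⊓ (b ⊔ c) ≤ b ⊔ c := inf_le_right
      rw [le_def] at hle
      rw [← hle, mul_add] at h
      have := K.add_self (K.e * K.y i * (a ⊓ (b ⊔ c)).1)
      rw [← add_zero (K.e * K.y i * (a ⊓ (b ⊔ c)).1), ← h, ← add_assoc, this]
    rcases supp_sup b c i hi' with h | h
    · exact le_sup_of_le_left (le_inf hia (gen_le h))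
    · exact le_sup_of_le_right (le_inf hia (gen_le h))

instance : Nontrivial K.CornerLattice :=
  ⟨⟨⟨K.e, K.e_mul_e⟩, ⊥, fun h => K.e_ne_zero (congrArg Subtype.val h)⟩⟩

end CornerLattice

/-- The action of `S` on the left ideal `S e`. -/
noncomputable def toEnd : S →+* EndSemiring K.CornerLattice where
  toFun s :=
    { toFun := fun a => (⟨s * a.1, by rw [mul_assoc, a.2]⟩ : K.CornerLattice)
      map_zero' := CornerLattice.ext (mul_zero s)
      map_add' := fun a b => CornerLattice.ext (mul_add s a.1 b.1) }
  map_one' := AddMonoidHom.ext fun a => CornerLattice.ext (one_mul a.1)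
  map_mul' s t := AddMonoidHom.ext fun a => CornerLattice.ext (mul_assoc s t a.1)
  map_zero' := AddMonoidHom.ext fun a => CornerLattice.ext (zero_mul a.1)
  map_add' s t := AddMonoidHom.ext fun a => CornerLattice.ext (add_mul s t a.1)

theorem toEnd_bijective : Function.Bijective K.toEnd := by
  constructor
  · intro s t h
    have key : ∀ i, s * (K.x i * K.e) = t * (K.x i * K.e) := fun i =>
      congrArg Subtype.val (DFunLike.congr_fun h (CornerLattice.gen K i))
    rw [← mul_one s, ← mul_one t, ← K.sum_eq_one, Finset.mul_sum, Finset.mul_sum]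
    exact Finset.sum_congr rfl fun i _ => by
      rw [← mul_assoc, key, mul_assoc]
  · intro h
    let h' : K.CornerLattice → K.CornerLattice := h
    have hsup : ∀ (s : Finset K.ι) (g : K.ι → K.CornerLattice), h' (s.sup g) = s.sup (h' ∘ g) := by
      intro s g
      exact Finset.apply_sup_eq_sup_comp h' (map_add h) (map_zero h)
    -- Since `e * y i * a` is `e` or `0` according to whether `i ∈ supp a`, this element acts on `a`
    -- as the join of the `h (gen i)` over `supp a`.
    refine ⟨∑ i, (h' (CornerLattice.gen K i)).1 * K.y i, AddMonoidHom.ext fun (a : K.CornerLattice) =>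
      CornerLattice.ext ?_⟩
    change (∑ i, (h' (CornerLattice.gen K i)).1 * K.y i) * a.1 = (h' a).1
    conv_rhs => rw [← CornerLattice.sup_supp a, hsup, CornerLattice.sup_finset_val]
    classical
    rw [CornerLattice.supp, Finset.sum_filter, Finset.sum_mul]
    refine Finset.sum_congr rfl fun i _ => ?_
    rw [← (h' (CornerLattice.gen K i)).2, mul_assoc, mul_assoc, ← mul_assoc K.e]
    rcases CornerLattice.corner_mul i a with h0 | h0 <;> rw [h0]
    · simp
    · rw [if_pos K.e_ne_zero]
      exact (h' (CornerLattice.gen K i)).2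

include K in
theorem exists_ringEquiv_endSemiring :
    ∃ (L : Type u) (_ : DistribLattice L) (_ : OrderBot L),
      Finite L ∧ Nontrivial L ∧ Nonempty (S ≃+* EndSemiring L) :=
  ⟨K.CornerLattice, inferInstance, inferInstance, inferInstance, inferInstance,
    ⟨RingEquiv.ofBijective K.toEnd K.toEnd_bijective⟩⟩

end BooleanCorner

/-! ### Simple semirings: the ring case and the idempotent case -/

variable {S : Type u} [Semiring S]

theorem IdealSimple.one_ne_zero (h : IdealSimple S) : (1 : S) ≠ 0 := fun h1 =>
  h.1 ((Ideal.eq_top_iff_one _).2 (by rw [h1]; exact zero_mem _))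

/-- A simple semiring is a ring or additively idempotent. -/
theorem SimpleSemiring.forall_exists_neg_or_one_add_one (h : SimpleSemiring S) :
    (∀ x : S, ∃ y, x + y = 0) ∨ (1 : S) + 1 = 1 := by
  let V : Ideal S :=
    { carrier := {x | ∃ y, x + y = 0}
      add_mem' := fun {a b} ⟨a', ha⟩ ⟨b', hb⟩ =>
        ⟨a' + b', by rw [add_add_add_comm, ha, hb, add_zero]⟩
      zero_mem' := ⟨0, add_zero 0⟩
      smul_mem' := fun c x ⟨y, hy⟩ => ⟨c * y, by rw [smul_eq_mul, ← mul_add, hy, mul_zero]⟩ }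
  have hV : V.IsTwoSided := ⟨fun {a} b ⟨a', ha⟩ => ⟨a' * b, by rw [← add_mul, ha, zero_mul]⟩⟩
  rcases h.2.2 V hV with hV | hV
  swap
  · exact .inl fun x => (hV ▸ Submodule.mem_top : x ∈ V)
  right
  -- `P x y` says that `x` lies below a multiple of `y`. The symmetrized relation identifies `1 + 1`
  -- with `1`; it is not universal, since `1 ~ 0` would make `1` additively invertible.
  let P : S → S → Prop := fun x y => ∃ (n : ℕ) (z : S), n • y = x + z
  have Prefl : ∀ x, P x x := fun x => ⟨1, 0, by simp⟩
  have Ptrans : ∀ {x y z}, P x y → P y z → P x z := fun {x y z} ⟨n, a, h⟩ ⟨m, b, h'⟩ =>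
    ⟨n * m, a + n • b, by rw [mul_nsmul', h', nsmul_add, h, add_assoc]⟩
  have Padd : ∀ {x y x' y'}, P x y → P x' y' → P (x + x') (y + y') :=
    fun {x y x' y'} ⟨n, a, h⟩ ⟨m, b, h'⟩ => ⟨n + m, a + b + (m • y + n • y'), by
      rw [← add_assoc, add_add_add_comm x, ← h, ← h', nsmul_add,
        add_nsmul, add_nsmul]
      abel⟩
  have Pmul : ∀ {x y x' y'}, P x y → P x' y' → P (x * x') (y * y') :=
    fun {x y x' y'} ⟨n, a, h⟩ ⟨m, b, h'⟩ => ⟨n * m, x * b + a * (x' + b), by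
      rw [← smul_mul_smul_comm, h, h', add_mul, mul_add, add_assoc]⟩
  let c : RingCon S :=
    { r := fun x y => P x y ∧ P y x
      iseqv := ⟨fun x => ⟨Prefl x, Prefl x⟩, fun h => ⟨h.2, h.1⟩,
        fun h h' => ⟨Ptrans h.1 h'.1, Ptrans h'.2 h.2⟩⟩
      add' := fun h h' => ⟨Padd h.1 h'.1, Padd h.2 h'.2⟩
      mul' := fun h h' => ⟨Pmul h.1 h'.1, Pmul h.2 h'.2⟩ }
  have h12 : c (1 + 1) 1 := ⟨⟨2, 0, by rw [two_nsmul, add_zero]⟩, ⟨1, 1, one_nsmul _⟩⟩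
  rcases h.1 c with hc | hc
  · rw [hc] at h12
    exact h12
  · have h10 : c 1 0 := by rw [hc]; trivial
    obtain ⟨n, z, hz⟩ := h10.1
    rw [nsmul_zero] at hz
    have : (1 : S) ∈ V := ⟨z, hz.symm⟩
    rw [hV] at this
    exact absurd (by simpa using this) h.2.one_ne_zero

/-- An additively idempotent semiring that is e-injective over itself has a top element. -/
theorem EInjective.exists_top (hS : EInjective S S) (h1 : (1 : S) + 1 = 1) :
    ∃ u : S, ∀ m, m + u = u := by
  have idem : ∀ a : S, a + a = a := fun a => by rw [← mul_one a, ← mul_add, h1]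
  have zsf : ∀ {a b : S}, a + b = 0 → a = 0 := fun {a b} h => by
    rw [← add_zero a, ← h, ← add_assoc, idem]
  -- The first factor stays embedded (take `s = 1` over second coordinate `0`), while over second
  -- coordinate `1` all first coordinates are identified. A retraction onto `S` therefore sends the
  -- class of `(0, 1)` to a greatest element.
  let c : ModuleCon S (S × S) :=
    { r := fun m n => m.2 = n.2 ∧ ∀ s, s * m.2 = 0 → s * m.1 = s * n.1
      iseqv := ⟨fun m => ⟨rfl, fun _ _ => rfl⟩,
        fun h => ⟨h.1.symm, fun s hs => (h.2 s (h.1 ▸ hs)).symm⟩,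
        fun h h' => ⟨h.1.trans h'.1, fun s hs => (h.2 s hs).trans (h'.2 s (h.1 ▸ hs))⟩⟩
      add' := fun {w x y z} h h' => ⟨congrArg₂ (· + ·) h.1 h'.1, fun s hs => by
        rw [Prod.snd_add, mul_add] at hs
        rw [Prod.fst_add, Prod.fst_add, mul_add, mul_add, h.2 s (zsf hs),
          h'.2 s (zsf ((add_comm _ _).trans hs))]⟩
      smul := fun t {x y} h => ⟨congrArg (t • ·) h.1, fun s hs => by
        change s * (t * x.2) = 0 at hs
        change s * (t * x.1) = s * (t * y.1)
        rw [← mul_assoc, ← mul_assoc]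
        exact h.2 _ (by rwa [mul_assoc])⟩ }
  let q : S × S →ₗ[S] c.Quotient :=
    { toFun := fun b => Quotient.mk c.toSetoid b
      map_add' := fun _ _ => rfl
      map_smul' := fun _ _ => rfl }
  have hq : ∀ m n, q m = q n ↔ m.2 = n.2 ∧ ∀ s, s * m.2 = 0 → s * m.1 = s * n.1 :=
    fun m n => Quotient.eq
  have hinj : Function.Injective (q ∘ₗ LinearMap.inl S S S) := fun a b h => by
    simpa using ((hq (a, 0) (b, 0)).1 h).2 1 (mul_zero 1)
  obtain ⟨r, hr⟩ := hS.exists_extension hinj (fun b a a' h => by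
    obtain ⟨⟨m, p⟩, rfl⟩ := Quotient.mk_surjective b
    have h' : q ((m, p) + (a, 0)) = q (a', 0) := h
    have hp : p = 0 := by simpa using ((hq _ _).1 h').1
    exact ⟨m, by rw [hp]; rfl⟩) LinearMap.id
  refine ⟨r (q (0, 1)), fun m => ?_⟩
  conv_lhs => rw [← LinearMap.id_apply (R := S) m, ← hr m]
  rw [LinearMap.comp_apply, ← map_add, ← map_add]
  congr 1
  rw [hq]
  refine ⟨by simp, fun s hs => ?_⟩
  have : s = 0 := by simpa using hs
  rw [this, zero_mul, zero_mul]

/-- The top element of a simple additively idempotent semiring gives a Boolean corner. -/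
theorem SimpleSemiring.nonempty_booleanCorner (h : SimpleSemiring S) (h1 : (1 : S) + 1 = 1)
    {u : S} (hu : ∀ m, m + u = u) : Nonempty (BooleanCorner S) := by
  have idem : ∀ a : S, a + a = a := fun a => by rw [← mul_one a, ← mul_add, h1]
  have hu0 : u ≠ 0 := fun hu0 => h.2.one_ne_zero (by have := hu 1; rwa [hu0, add_zero] at this)
  have huu : u * u = u := by
    have := congrArg (u * ·) (hu 1)
    simp only [mul_add, mul_one] at this
    rw [← this, add_comm, hu]
  have corner : ∀ s, s ≠ 0 → u * s * u = u := by
    intro s hs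
    have left : ∀ a, a * (u * s * u) + u * s * u = u * s * u := fun a => by
      rw [← mul_assoc, ← mul_assoc, ← add_mul, ← add_mul, hu]
    have right : ∀ a, u * s * u * a + u * s * u = u * s * u := fun a => by
      rw [mul_assoc, ← mul_add, hu]
    -- The elements below `u * s * u` form a two-sided ideal containing `s`, hence everything; `1 ≤
    -- u * s * u` then gives `u ≤ u * s * u`.
    let I : Ideal S :=
      { carrier := {t | t + u * s * u = u * s * u}
        add_mem' := fun {a b} (ha : _ = _) (hb : _ = _) => by
          change a + b + _ = _
          rw [add_assoc, hb, ha]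
        zero_mem' := zero_add _
        smul_mem' := fun a t (ht : _ = _) => by
          change a * t + _ = _
          conv_lhs => rw [← left a]
          rw [← add_assoc, ← mul_add, ht, left] }
    have hI : I.IsTwoSided := ⟨fun {t} a (ht : _ = _) => by
      change t * a + _ = _
      conv_lhs => rw [← right a]
      rw [← add_assoc, ← add_mul, ht, right]⟩
    have hsI : s ∈ I := by
      have hus : s + u * s = u * s := by simpa [add_mul] using congrArg (· * s) (hu 1)
      have husu : u * s + u * s * u = u * s * u := by
        simpa [mul_add] using congrArg (u * s * ·) (hu 1)
      change s + _ = _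
      rw [← husu, ← add_assoc, hus]
    have htop : I = ⊤ := (h.2.2 I hI).resolve_left fun hbot => hs (by rwa [hbot] at hsI)
    have h1I : 1 + u * s * u = u * s * u := (htop ▸ Submodule.mem_top : (1 : S) ∈ I)
    have := congrArg (u * ·) h1I
    simp only [mul_add, mul_one, ← mul_assoc, huu] at this
    rw [← this, add_comm, hu]
  let J : Ideal S := Ideal.span (Set.range fun y => u * y)
  have hJ : J.IsTwoSided := ⟨fun {a} b ha => by
    refine Submodule.span_induction (p := fun a _ => a * b ∈ J) ?_ ?_ ?_ ?_ ha
    · rintro _ ⟨y, rfl⟩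
      exact Ideal.subset_span ⟨y * b, (mul_assoc _ _ _).symm⟩
    · rw [zero_mul]
      exact J.zero_mem
    · intro x y _ _ hx hy
      rw [add_mul]
      exact J.add_mem hx hy
    · intro c x _ hx
      rw [smul_eq_mul, mul_assoc]
      exact J.mul_mem_left _ hx⟩
  have hJtop : J = ⊤ := (h.2.2 J hJ).resolve_left fun hbot => hu0 (by
    have : u * 1 ∈ J := Ideal.subset_span ⟨1, rfl⟩
    simpa [hbot] using this)
  have h1J : (1 : S) ∈ Submodule.span S (Set.range fun y => u * y) :=
    (hJtop ▸ Submodule.mem_top : (1 : S) ∈ J)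
  obtain ⟨c, hc⟩ := Finsupp.mem_span_range_iff_exists_finsupp.1 h1J
  refine ⟨{
    one_add_one := h1
    e := u
    e_ne_zero := hu0
    e_mul_e := huu
    corner := fun s => ?_
    ι := c.support
    fintype := inferInstance
    x := fun i => c i
    y := fun i => i
    sum_eq_one := ?_ }⟩
  · by_cases hs : s = 0
    · exact .inl (by rw [hs, mul_zero, zero_mul])
    · exact .inr (corner s hs)
  · simp only [Finsupp.sum, smul_eq_mul, ← mul_assoc] at hc
    rw [← hc]
    exact Finset.sum_coe_sort c.support fun y => c y * u * y

/-! ### Injectivity and simplicity over rings -/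

section Ring

variable {R : Type u} [Ring R]

/-- Over an e-injective semimodule, every consistent system of equations `g a • x = m a` has a
solution. -/
theorem EInjective.exists_smul_eq {M : Type u} [AddCommMonoid M] [Module R M]
    (hM : EInjective R M) {α : Type*} (g : α → R) (m : α → M)
    (h : ∀ c : α →₀ R, c.sum (fun a r => r * g a) = 0 → c.sum (fun a r => r • m a) = 0) :
    ∃ x : M, ∀ a, g a • x = m a := by
  let _ : AddCommGroup M := Module.addCommMonoidToAddCommGroup R
  let G := Finsupp.linearCombination R g
  let T := Finsupp.linearCombination R m
  have hker : LinearMap.ker G ≤ LinearMap.ker T := fun c hc => h c hc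
  -- By consistency, `g a ↦ m a` is well defined on the left ideal generated by the `g a`; the
  -- solution is the value at `1` of an extension to `R`.
  let φ : LinearMap.range G →ₗ[R] M :=
    (LinearMap.ker G).liftQ T hker ∘ₗ G.quotKerEquivRange.symm.toLinearMap
  obtain ⟨ψ, hψ⟩ := hM.exists_extension (LinearMap.range G).subtype_injective
    (fun b a a' e => ⟨a' - a, by rw [map_sub, ← e, add_sub_cancel_right]⟩) φ
  refine ⟨ψ 1, fun a => ?_⟩
  have ha : G (Finsupp.single a 1) = g a := by simp [G]
  have hmem : g a ∈ LinearMap.range G := ⟨_, ha⟩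
  rw [← map_smul, smul_eq_mul, mul_one]
  have hsymm : G.quotKerEquivRange.symm ⟨g a, hmem⟩ =
      (LinearMap.ker G).mkQ (Finsupp.single a 1) := by
    rw [LinearEquiv.symm_apply_eq]
    exact Subtype.ext ha.symm
  refine ((hψ ⟨g a, hmem⟩).trans (congrArg ((LinearMap.ker G).liftQ T hker) hsymm)).trans ?_
  simp [T]

theorem eInjective_of_isSemisimpleRing [IsSemisimpleRing R] (M : Type u) [AddCommMonoid M]
    [Module R M] : EInjective R M := by
  let _ : AddCommGroup M := Module.addCommMonoidToAddCommGroup R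
  refine eInjective_of_extension fun A B _ _ _ _ f hf _ => ⟨fun φ => ?_, fun φ ψ e => ?_⟩
  · let _ : AddCommGroup A := Module.addCommMonoidToAddCommGroup R
    let _ : AddCommGroup B := Module.addCommMonoidToAddCommGroup R
    exact IsSemisimpleModule.extension_property f hf φ
  · refine ⟨ψ - φ, 0, ?_, LinearMap.zero_comp _, by simp⟩
    rw [LinearMap.sub_comp, e, sub_self]

theorem SimpleSemiring.isSimpleRing (h : SimpleSemiring R) : IsSimpleRing R :=
  isSimpleRing_iff_isTwoSided_imp.2 ⟨⟨1, 0, h.2.one_ne_zero⟩, h.2.2⟩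

theorem simpleSemiring_of_isSimpleRing [IsSimpleRing R] : SimpleSemiring R := by
  obtain ⟨_, h⟩ := isSimpleRing_iff_isTwoSided_imp.1 ‹IsSimpleRing R›
  refine ⟨fun c => ?_, bot_ne_top, h⟩
  rcases eq_bot_or_eq_top (TwoSidedIdeal.orderIsoRingCon.symm c) with h | h
  · left
    exact ((OrderIso.symm_apply_eq _).1 h).trans (OrderIso.map_bot _)
  · right
    exact ((OrderIso.symm_apply_eq _).1 h).trans (OrderIso.map_top _)

end Ring

/-! ### Osofsky's theorem -/

section Osofsky

variable {R : Type u} [Ring R]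

/-- The left ideals generated by the members of the family form a direct sum. -/
def IndepFamily {ι : Type*} (f : ι → R) : Prop :=
  ∀ c : ι →₀ R, c.sum (fun i r => r * f i) = 0 → ∀ i, c i * f i = 0

/-- The left ideals generated by the members of the set form a direct sum. -/
def IndepSet (s : Set R) : Prop :=
  ∀ c : R →₀ R, ↑c.support ⊆ s → c.sum (fun x r => r * x) = 0 → ∀ x, c x * x = 0

theorem IndepSet.indepFamily {s : Set R} (hs : IndepSet s) :
    IndepFamily (fun x : s => (x : R)) := by
  intro c hc x
  have := hs (c.embDomain (Function.Embedding.subtype (· ∈ s)))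
    (by rw [Finsupp.support_embDomain]; intro y hy; obtain ⟨z, -, rfl⟩ := Finset.mem_map.1 hy
        exact z.2) (by rw [Finsupp.sum_embDomain]; exact hc) x
  rwa [show (x : R) = Function.Embedding.subtype (· ∈ s) x from rfl,
    Finsupp.embDomain_apply_self] at this

theorem IndepSet.insert {s : Set R} (hs : IndepSet s) {z : R}
    (hz : ∀ r, r * z ∈ Ideal.span s → r * z = 0) : IndepSet (insert z s) := by
  classical
  by_cases hzs : z ∈ s
  · rwa [Set.insert_eq_of_mem hzs]
  intro c hc h0
  have hsum : c z * z + (c.erase z).sum (fun x r => r * x) = 0 := by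
    rw [← h0]
    exact Finsupp.add_sum_erase' c z (fun x r => r * x) fun x => zero_mul x
  have hsupp : ↑(c.erase z).support ⊆ s := by
    intro x hx
    rw [Finsupp.support_erase, Finset.mem_coe, Finset.mem_erase] at hx
    exact (hc hx.2).resolve_left hx.1
  have hcz : c z * z = 0 := by
    apply hz
    rw [eq_neg_of_add_eq_zero_left hsum]
    exact neg_mem (Submodule.sum_mem _ fun x hx =>
      Ideal.mul_mem_left _ _ (Ideal.subset_span (hsupp hx)))
  rw [hcz, zero_add] at hsum
  intro x
  by_cases hx : x = z
  · rw [hx, hcz]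
  · rw [← Finsupp.erase_ne hx]
    exact hs _ hsupp hsum x

/-- Independence involves finitely many elements at a time, so Zorn applies; maximality makes the
span essential in `K`. -/
theorem exists_maximal_indepSet (K : Ideal R) {s₀ : Set R} (h₀ : IndepSet s₀)
    (hK₀ : s₀ ⊆ K) (hz₀ : (0 : R) ∉ s₀) :
    ∃ s : Set R, s₀ ⊆ s ∧ s ⊆ K ∧ (0 : R) ∉ s ∧ IndepSet s ∧
      ∀ z ∈ K, z ≠ 0 → ∃ r, r * z ∈ Ideal.span s ∧ r * z ≠ 0 := by
  obtain ⟨s, h₀s, hs⟩ := zorn_subset_nonempty {s : Set R | s ⊆ K ∧ (0 : R) ∉ s ∧ IndepSet s}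
    (fun c hc hchain hne => ⟨⋃₀ c, ⟨Set.sUnion_subset fun t ht => (hc ht).1,
      fun ⟨t, ht, h⟩ => (hc ht).2.1 h, fun d hd => by
        obtain ⟨t, ht, hdt⟩ := DirectedOn.exists_mem_subset_of_finset_subset_biUnion
          (f := id) hne (IsChain.directedOn hchain) (s := d.support)
          (by rwa [Set.sUnion_eq_biUnion] at hd)
        exact (hc ht).2.2 d hdt⟩, fun t ht => Set.subset_sUnion_of_mem ht⟩) s₀ ⟨hK₀, hz₀, h₀⟩
  refine ⟨s, h₀s, hs.1.1, hs.1.2.1, hs.1.2.2, fun z hzK hz => ?_⟩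
  by_contra! h
  have hins := hs.2 (y := insert z s) ⟨Set.insert_subset hzK hs.1.1, by
    rintro (h' | h')
    · exact hz h'.symm
    · exact hs.1.2.1 h', hs.1.2.2.insert h⟩ (Set.subset_insert z s)
  exact hz (by simpa using h 1 (by rw [one_mul]; exact Ideal.subset_span (hins (.inl rfl))))

theorem IsCyclic.span_singleton (a : R) : IsCyclic R (Ideal.span {a}) :=
  ⟨(LinearMap.toSpanSingleton R R a).codRestrict _ fun r =>
    Ideal.mul_mem_left _ _ (Ideal.mem_span_singleton_self a), fun ⟨x, hx⟩ => by
      obtain ⟨r, rfl⟩ := Ideal.mem_span_singleton'.1 hx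
      exact ⟨r, rfl⟩⟩

variable (hR : ∀ (M : Type u) [AddCommMonoid M] [Module R M], IsCyclic R M → EInjective R M)

include hR

theorem exists_mul_mul_eq (a : R) : ∃ t, a * t * a = a := by
  let a' : Ideal.span {a} := ⟨a, Ideal.mem_span_singleton_self a⟩
  obtain ⟨⟨x, hx⟩, hax⟩ := (hR _ (IsCyclic.span_singleton a)).exists_smul_eq
    (fun _ : Unit => a) (fun _ => a') fun c hc => Subtype.ext
      ((map_sum (Submodule.subtype _) _ _).trans hc)
  obtain ⟨t, rfl⟩ := Ideal.mem_span_singleton'.1 hx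
  exact ⟨t, (mul_assoc _ _ _).trans (congrArg Subtype.val (hax ()))⟩

section Family

variable {ι : Type*} {f : ι → R} (hf : IndepFamily f)

include hf in
open Classical in
theorem exists_mul_eq_ite (A : Set ι) : ∃ E : R, ∀ i, f i * E = if i ∈ A then f i else 0 := by
  refine (hR R ⟨LinearMap.id, Function.surjective_id⟩).exists_smul_eq f _ fun c hc => ?_
  refine Finset.sum_eq_zero fun i _ => ?_
  simp only [smul_eq_mul, mul_ite, mul_zero, hf c hc i, ite_self]

include hf in
open Classical in
theorem exists_mem_span_mul_eq_ite (i : ι) :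
    ∃ e ∈ Ideal.span {f i}, ∀ j, f j * e = if j = i then f i else 0 := by
  let a' : Ideal.span {f i} := ⟨f i, Ideal.mem_span_singleton_self _⟩
  obtain ⟨⟨e, he⟩, h⟩ := (hR _ (IsCyclic.span_singleton (f i))).exists_smul_eq
    f (fun j => if j = i then a' else 0) fun c hc => by
      refine Finset.sum_eq_zero fun j _ => ?_
      change c j • (if j = i then a' else 0) = 0
      split_ifs with hj
      · subst hj
        exact Subtype.ext (hf c hc j)
      · exact smul_zero _
  refine ⟨e, he, fun j => ?_⟩
  have := congrArg Subtype.val (h j)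
  rw [apply_ite Subtype.val] at this
  exact this

/-- Over a von Neumann regular ring, an essential left ideal has no right annihilator. -/
theorem eq_zero_of_forall_mul_eq_zero
    (hess : ∀ z : R, z ≠ 0 → ∃ r, r * z ∈ Ideal.span (Set.range f) ∧ r * z ≠ 0) {y : R}
    (hy : ∀ i, f i * y = 0) : y = 0 := by
  by_contra hy0
  obtain ⟨t, ht⟩ := exists_mul_mul_eq hR y
  obtain ⟨r, hr, hr0⟩ := hess (y * t) fun h => hy0 (by rw [← ht, h, zero_mul])
  have hann : ∀ w ∈ Ideal.span (Set.range f), w * y = 0 := fun w hw => by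
    refine Submodule.span_induction (p := fun w _ => w * y = 0) ?_ (zero_mul y) ?_ ?_ hw
    · rintro _ ⟨i, rfl⟩
      exact hy i
    · intro a b _ _ ha hb
      rw [add_mul, ha, hb, add_zero]
    · intro c a _ ha
      rw [smul_eq_mul, mul_assoc, ha, mul_zero]
  have := hann _ hr
  rw [mul_assoc, ht] at this
  exact hr0 (by rw [← mul_assoc, this, zero_mul])

include hf in
-- A diagonal argument: an infinite family yields a consistent system over the cyclic module `R ⧸ I`
-- whose solution is contradictory.
theorem finite_of_indepFamily (hf0 : ∀ i, f i ≠ 0)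
    (hess : ∀ z : R, z ≠ 0 → ∃ r, r * z ∈ Ideal.span (Set.range f) ∧ r * z ≠ 0) :
    Finite ι := by
  classical
  by_contra hfin
  have : Infinite ι := not_finite_iff_infinite.1 hfin
  choose E hE using exists_mul_eq_ite hR hf
  choose e heI he using exists_mem_span_mul_eq_ite hR hf
  have ann : ∀ {y z : R}, (∀ i, f i * y = f i * z) → y = z := fun h =>
    sub_eq_zero.1 (eq_zero_of_forall_mul_eq_zero hR hess fun i => by rw [mul_sub, h, sub_self])
  set I := Ideal.span (Set.range f)
  have heI' : ∀ i, e i ∈ I := fun i =>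
    Ideal.span_mono (Set.singleton_subset_iff.2 (Set.mem_range_self i)) (heI i)
  have hIe : ∀ z ∈ I, {i | z * e i ≠ 0}.Finite := fun z hz => by
    obtain ⟨c, rfl⟩ := Finsupp.mem_span_range_iff_exists_finsupp.1 hz
    refine c.support.finite_toSet.subset fun i hi => ?_
    by_contra hic
    refine hi ?_
    rw [Finsupp.sum, Finset.sum_mul]
    refine Finset.sum_eq_zero fun j hj => ?_
    rw [smul_eq_mul, mul_assoc, he, if_neg, mul_zero]
    rintro rfl
    exact hic hj
  let p : ℕ × ℕ → ι := fun q => Infinite.natEmbedding ι (Nat.pairEquiv q)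
  have hp : Function.Injective p :=
    (Infinite.natEmbedding ι).injective.comp Nat.pairEquiv.injective
  -- Infinitely many disjoint infinite blocks. The system asks `x` to be `1` modulo `I` on each
  -- block, and `0` on each set meeting every block finitely.
  let P : ℕ → Set ι := fun k => Set.range fun n => p (k, n)
  let g : ℕ ⊕ {A : Set ι // ∀ k, (A ∩ P k).Finite} → R := Sum.elim (fun k => E (P k)) fun A => E A.1
  let m : ℕ ⊕ {A : Set ι // ∀ k, (A ∩ P k).Finite} → R ⧸ I :=
    Sum.elim (fun k => I.mkQ (E (P k))) fun _ => 0
  obtain ⟨x, hx⟩ := (hR (R ⧸ I) ⟨I.mkQ, I.mkQ_surjective⟩).exists_smul_eq g m fun c hc => by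
    -- Only finitely many blocks occur in a given relation, and `E C` for their union solves all the
    -- equations involved.
    let C : Set ι := ⋃ k ∈ {k : ℕ | Sum.inl k ∈ c.support}, P k
    have key : ∀ a ∈ c.support, m a = I.mkQ (g a * E C) := by
      rintro (k | A) ha
      · refine congrArg I.mkQ (ann fun i => ?_)
        change f i * E (P k) = f i * (E (P k) * E C)
        rw [← mul_assoc, hE]
        split_ifs with hi
        · rw [hE, if_pos]
          exact Set.mem_biUnion (x := k) ha hi
        · rw [zero_mul]
      · symm
        refine (Submodule.Quotient.mk_eq_zero I).2 ?_
        have hfinC : (A.1 ∩ C).Finite := by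
          have : A.1 ∩ C = ⋃ k ∈ {k : ℕ | Sum.inl k ∈ c.support}, A.1 ∩ P k := by
            rw [Set.inter_iUnion₂]
          rw [this]
          exact Set.Finite.biUnion (c.support.finite_toSet.preimage Sum.inl_injective.injOn)
            fun k _ => A.2 k
        have : g (Sum.inr A) * E C = ∑ i ∈ hfinC.toFinset, e i := by
          refine ann fun i => ?_
          change f i * (E A.1 * E C) = _
          rw [← mul_assoc, hE, Finset.mul_sum]
          simp only [he, Finset.sum_ite_eq, Set.Finite.mem_toFinset, Set.mem_inter_iff]
          by_cases h : i ∈ A.1 <;> by_cases h' : i ∈ C <;> simp [h, h', hE]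
        rw [this]
        exact I.sum_mem fun i _ => heI' i
    calc c.sum (fun a r => r • m a) = c.sum fun a r => r • I.mkQ (g a * E C) :=
          Finset.sum_congr rfl fun a ha => congrArg (c a • ·) (key a ha)
      _ = I.mkQ ((c.sum fun a r => r * g a) * E C) := by
          simp only [Finsupp.sum, Finset.sum_mul, map_sum, ← map_smul, smul_eq_mul, mul_assoc]
      _ = 0 := by rw [hc, zero_mul, map_zero]
  obtain ⟨x, rfl⟩ := I.mkQ_surjective x
  have hk : ∀ k, E (P k) * x - E (P k) ∈ I := fun k =>
    (Submodule.Quotient.eq I).1 (hx (Sum.inl k))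
  have hA : ∀ A : Set ι, (∀ k, (A ∩ P k).Finite) → E A * x ∈ I := fun A h =>
    (Submodule.Quotient.mk_eq_zero I).1 (hx (Sum.inr ⟨A, h⟩))
  -- Elements of `I` kill almost all `e i`, so some point of the block sees no error; choosing one
  -- per block gives a set that meets each block once.
  have hn : ∀ k, ∃ n, (E (P k) * x - E (P k)) * e (p (k, n)) = 0 := fun k => by
    by_contra! h
    refine Set.infinite_of_injective_forall_mem (f := fun n => p (k, n))
      (fun a b hab => (Prod.ext_iff.1 (hp hab)).2) h (hIe _ (hk k))
  choose n hn using hn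
  let b : ℕ → ι := fun k => p (k, n k)
  have hB : ∀ k, (Set.range b ∩ P k).Finite := fun k => by
    refine (Set.finite_singleton (b k)).subset ?_
    rintro _ ⟨⟨l, rfl⟩, ⟨j, hj⟩⟩
    have : k = l := (Prod.ext_iff.1 (hp hj)).1
    rw [this]
    rfl
  obtain ⟨k, hkb⟩ : ∃ k, E (Set.range b) * x * e (b k) = 0 := by
    by_contra! h
    exact Set.infinite_of_injective_forall_mem (f := b)
      (fun a b hab => (Prod.ext_iff.1 (hp hab)).1) h (hIe _ (hA _ hB))
  apply hf0 (b k)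
  have h1 := congrArg (f (b k) * ·) hkb
  have h2 := congrArg (f (b k) * ·) (hn k)
  simp only [← mul_assoc, mul_sub, sub_mul, hE, mul_zero] at h1 h2
  rw [if_pos (Set.mem_range_self k)] at h1
  rw [if_pos ⟨n k, rfl⟩] at h2
  change f (b k) * x * e (b k) - f (b k) * e (b k) = 0 at h2
  rw [h1, he, if_pos rfl, zero_sub, neg_eq_zero] at h2
  exact h2

end Family

/-- **Osofsky's theorem**: a ring whose cyclic left modules are injective is semisimple. -/
theorem isSemisimpleRing_of_cyclic_eInjective : IsSemisimpleRing R := by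
  classical
  refine { exists_isCompl := fun K => ?_ }
  obtain ⟨s, -, hsK, hs0, hs, hess⟩ := exists_maximal_indepSet K (s₀ := ∅)
    (fun c hc _ x => by
      rw [Finsupp.support_eq_empty.1 (Finset.coe_eq_empty.1 (Set.subset_empty_iff.1 hc))]
      simp) (Set.empty_subset _) (Set.notMem_empty _)
  obtain ⟨s', hss', -, hs0', hs', hess'⟩ :=
    exists_maximal_indepSet (⊤ : Ideal R) hs (Set.subset_univ _) hs0
  have hfin : Finite s' := finite_of_indepFamily hR hs'.indepFamily
    (fun x h => hs0' (h ▸ x.2)) fun z hz => by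
      rw [Subtype.range_coe]
      exact hess' z Submodule.mem_top hz
  have : Fintype s := ((Set.toFinite s').subset hss').fintype
  choose e heK he using exists_mem_span_mul_eq_ite hR hs.indepFamily
  let E := ∑ i, e i
  have hEs : E ∈ Ideal.span s := Ideal.sum_mem _ fun i _ =>
    Ideal.span_mono (Set.singleton_subset_iff.2 i.2) (heK i)
  -- Right multiplication by `E` fixes the span of `s`; as that span is essential in `K`, it must
  -- fix all of `K`.
  have hsE : ∀ w ∈ Ideal.span s, w * E = w := fun w hw => by
    refine Submodule.span_induction (p := fun w _ => w * E = w) ?_ (zero_mul _) ?_ ?_ hw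
    · intro x hx
      rw [Finset.mul_sum]
      calc ∑ i, x * e i = ∑ i, if (⟨x, hx⟩ : s) = i then (i : R) else 0 :=
            Finset.sum_congr rfl fun i _ => by convert he i ⟨x, hx⟩
        _ = x := by simp
    · intro a b _ _ ha hb
      rw [add_mul, ha, hb]
    · intro c a _ ha
      rw [smul_eq_mul, mul_assoc, ha]
  have hEK : E ∈ K := Ideal.span_le.2 hsK hEs
  refine ⟨_, LinearMap.isCompl_of_proj
    (f := (LinearMap.toSpanSingleton R R E).codRestrict K fun r => K.smul_mem r hEK)
    fun x => Subtype.ext ?_⟩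
  change (x : R) * E = x
  by_contra hne
  obtain ⟨r, hr, hr0⟩ := hess (x - x * E) (K.sub_mem x.2 (K.smul_mem _ hEK))
    (sub_ne_zero.2 (Ne.symm hne))
  apply hr0
  rw [← hsE _ hr, mul_assoc, sub_mul, mul_assoc, hsE E hEs, sub_self, mul_zero]

end Osofsky

/-- A semiring in which every element has an additive inverse is a ring. -/
noncomputable abbrev ringOfForallExistsNeg {S : Type u} [Semiring S]
    (h : ∀ x : S, ∃ y, x + y = 0) : Ring S :=
  let _ : Neg S := ⟨fun x => (h x).choose⟩
  { ‹Semiring S› with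
    neg := fun x => (h x).choose
    neg_add_cancel := fun x => (add_comm _ _).trans (h x).choose_spec
    zsmul := zsmulRec }

/-! ### Assembling the classification -/

theorem exists_ringEquiv_matrix_of_ring {R : Type u} [Ring R] (h : SimpleSemiring R)
    (hR : ∀ (M : Type u) [AddCommMonoid M] [Module R M], IsCyclic R M → EInjective R M) :
    ∃ (D : Type u) (_ : DivisionRing D) (n : ℕ),
      1 ≤ n ∧ Nonempty (R ≃+* Matrix (Fin n) (Fin n) D) := by
  have := h.isSimpleRing
  have : IsSemisimpleRing R := isSemisimpleRing_of_cyclic_eInjective hR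
  have : IsArtinianRing R := IsSimpleRing.isSemisimpleRing_iff_isArtinianRing.1 this
  obtain ⟨n, hn, D, hD, e⟩ := IsSimpleRing.exists_ringEquiv_matrix_divisionRing R
  exact ⟨D, hD, n, Nat.one_le_iff_ne_zero.2 hn.out, e⟩

theorem eInjective_of_ring_matrix {R : Type u} [Ring R] {D : Type u} [DivisionRing D] {n : ℕ}
    (hn : 1 ≤ n) (e : R ≃+* Matrix (Fin n) (Fin n) D) :
    SimpleSemiring R ∧ ∀ (M : Type u) [AddCommMonoid M] [Module R M], EInjective R M := by
  have : Nonempty (Fin n) := ⟨⟨0, hn⟩⟩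
  have : IsSimpleRing R := IsSimpleRing.of_ringEquiv e.symm inferInstance
  have : IsSemisimpleRing R := e.symm.isSemisimpleRing
  exact ⟨simpleSemiring_of_isSimpleRing, fun M _ _ => eInjective_of_isSemisimpleRing M⟩

theorem exists_ringEquiv_of_cyclic_eInjective {S : Type u} [Semiring S] (h : SimpleSemiring S)
    (hS : ∀ (M : Type u) [AddCommMonoid M] [Module S M], IsCyclic S M → EInjective S M) :
    (∃ (D : Type u) (_ : DivisionRing D) (n : ℕ),
      1 ≤ n ∧ Nonempty (S ≃+* Matrix (Fin n) (Fin n) D)) ∨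
    (∃ (L : Type u) (_ : DistribLattice L) (_ : OrderBot L),
      Finite L ∧ Nontrivial L ∧ Nonempty (S ≃+* EndSemiring L)) := by
  rcases h.forall_exists_neg_or_one_add_one with hneg | h1
  · left
    let _ : Ring S := ringOfForallExistsNeg hneg
    exact exists_ringEquiv_matrix_of_ring h hS
  · right
    obtain ⟨u, hu⟩ := (hS S ⟨LinearMap.id, Function.surjective_id⟩).exists_top h1
    obtain ⟨K⟩ := h.nonempty_booleanCorner h1 hu
    exact K.exists_ringEquiv_endSemiring

theorem simpleSemiring_and_eInjective_of_ringEquiv_matrix {S : Type u} [Semiring S] {D : Type u}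
    [DivisionRing D] {n : ℕ} (hn : 1 ≤ n) (e : S ≃+* Matrix (Fin n) (Fin n) D) :
    SimpleSemiring S ∧ ∀ (M : Type u) [AddCommMonoid M] [Module S M], EInjective S M := by
  let _ : Ring S := ringOfForallExistsNeg fun x =>
    ⟨e.symm (-e x), e.injective (by rw [map_add, e.apply_symm_apply, add_neg_cancel, map_zero])⟩
  exact eInjective_of_ring_matrix hn e

theorem simpleSemiring_and_eInjective_of_ringEquiv_endSemiring {S : Type u} [Semiring S]
    {L : Type u} [DistribLattice L] [OrderBot L] [Finite L] [Nontrivial L]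
    (e : S ≃+* EndSemiring L) :
    SimpleSemiring S ∧ ∀ (M : Type u) [AddCommMonoid M] [Module S M],
      Module.Finite S M → EInjective S M := by
  obtain ⟨K₀⟩ := nonempty_booleanCorner_endSemiring L
  let K := K₀.map e.symm
  have : Finite S := Finite.of_equiv _ e.symm.toEquiv
  refine ⟨K.simpleSemiring, fun M _ _ _ => ?_⟩
  have : Finite M := Module.finite_of_finite S
  exact K.eInjective_of_finite

end Semimod

theorem theorem6p10 (S : Type u) [Semiring S] :
    List.TFAE [
      Semimod.SimpleSemiring S ∧
        ∀ (M : Type u) [AddCommMonoid M] [Module S M],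
          Module.Finite S M → Semimod.EInjective S M,
      Semimod.SimpleSemiring S ∧
        ∀ (M : Type u) [AddCommMonoid M] [Module S M],
          Semimod.IsCyclic S M → Semimod.EInjective S M,
      (∃ (D : Type u) (_ : DivisionRing D) (n : ℕ),
          1 ≤ n ∧ Nonempty (S ≃+* Matrix (Fin n) (Fin n) D)) ∨
        (∃ (L : Type u) (_ : DistribLattice L) (_ : OrderBot L),
          Finite L ∧ Nontrivial L ∧ Nonempty (S ≃+* Semimod.EndSemiring L))] := by
  tfae_have 1 → 2 := fun ⟨h, hM⟩ => ⟨h, fun M _ _ ⟨p, hp⟩ => hM M (Module.Finite.of_surjective p hp)⟩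
  tfae_have 2 → 3 := fun ⟨h, hM⟩ => Semimod.exists_ringEquiv_of_cyclic_eInjective h hM
  tfae_have 3 → 1 := by
    rintro (⟨D, _, n, hn, ⟨e⟩⟩ | ⟨L, _, _, _, _, ⟨e⟩⟩)
    · obtain ⟨h, hM⟩ := Semimod.simpleSemiring_and_eInjective_of_ringEquiv_matrix hn e
      exact ⟨h, fun M _ _ _ => hM M⟩
    · exact Semimod.simpleSemiring_and_eInjective_of_ringEquiv_endSemiring e
  tfae_finish
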